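/- Let $n\ge 0$ and $q\ge 1$ be integers. For a measurable $(0,q)$-form $v=\sum'_{|J|=q} v_J\,d\bar z_J$ on $\mathbb C^n=\mathbb R^{2n}$ (sum over increasing multi-indices) write $|v|^2=\sum'_{|J|=q}|v_J|^2$; all integrals are with respect to Lebesgue measure, and $\bar\partial$ is taken in the sense of distributions. Let $\omega:\mathbb C^n\to[0,\infty]$ be a measurable function such that $$\int_{\mathbb C^n}\phi^2\,\omega\le\int_{\mathbb C^n}|\nabla\phi|^2$$ for every real-valued smooth function $\phi$ with compact support in $\mathbb C^n$, where $\nabla$ is the gradient on $\mathbb R^{2n}$. Then for every $\bar\partial$-closed $(0,q)$-form $v$ on $\mathbb C^n$ with $$\int_{\mathbb C^n}|v|^2<\infty\quad\text{and}\quad\int_{\mathbb C^n}|v|^2/\omega<\infty$$ (with the conventions $0/0=0$, $c/0=\infty$ for $c>0$, and $c/\infty=0$ for finite $c$), there exists a square-integrable $(0,q-1)$-form $u$ on $\mathbb C^n$ such that $\bar\partial u=v$ and $$\int_{\mathbb C^n}|u|^2\le 4\int_{\mathbb C^n}|v|^2/\omega .$$ -/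

import Mathlib

open MeasureTheory
open scoped ENNReal ContDiff Gradient

noncomputable section

/-- The space `ℂⁿ` with its Hermitian norm; as a real inner product space it is `ℝ²ⁿ`, and its
`volume` is Lebesgue measure. -/
abbrev ComplexSpace (n : ℕ) : Type := EuclideanSpace ℂ (Fin n)

/-- Increasing multi-indices `J = (j₁ < ⋯ < j_q)` with entries in `{1, …, n}`, encoded as subsets of
cardinality `q`. -/
abbrev MultiIndex (n q : ℕ) : Type := {J : Finset (Fin n) // J.card = q}

/-- A `(0,q)`-form `u = ∑'_J u_J dz̄_J` on `ℂⁿ`, given by its coefficient functions `u_J`, where `J`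
runs over the increasing multi-indices of length `q`. Its pointwise norm is
`|u|² = ∑'_J |u_J|²`, i.e. the `dz̄_J` are orthonormal. -/
abbrev AntiHolForm (n q : ℕ) : Type := ComplexSpace n → EuclideanSpace ℂ (MultiIndex n q)

/-- The multi-index `K \ {k}` of length `q`, for `k ∈ K` and `K` of length `q + 1`. -/
def MultiIndex.erase {n q : ℕ} (K : MultiIndex n (q + 1)) (k : {k : Fin n // k ∈ K.1}) :
    MultiIndex n q :=
  ⟨K.1.erase k.1, by rw [Finset.card_erase_of_mem k.2, K.2, Nat.add_sub_cancel]⟩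

/-- The sign `ε` determined by `dz̄_k ∧ dz̄_{K \ {k}} = ε dz̄_K`, for `k ∈ K`. -/
def MultiIndex.sign {n q : ℕ} (K : MultiIndex n (q + 1)) (k : {k : Fin n // k ∈ K.1}) : ℂ :=
  (-1) ^ (K.1.filter (fun l => l < k.1)).card

/-- The Wirtinger derivative `∂φ/∂z̄_k = ½ (∂φ/∂x_k + i ∂φ/∂y_k)`, where `z_k = x_k + i y_k`. -/
def wirtingerBar {n : ℕ} (k : Fin n) (φ : ComplexSpace n → ℂ) (z : ComplexSpace n) : ℂ :=
  (1 / 2) * (fderiv ℝ φ z (EuclideanSpace.single k 1)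
    + Complex.I * fderiv ℝ φ z (EuclideanSpace.single k Complex.I))

/-- `∂̄u = v` in the sense of distributions, for a `(0,q)`-form `u` and a `(0,q+1)`-form `v` with
locally integrable coefficients: for every `K`, the coefficient
`(∂̄u)_K = ∑_{k ∈ K} ε ∂u_{K \ {k}}/∂z̄_k`, with `dz̄_k ∧ dz̄_{K \ {k}} = ε dz̄_K`, computed as a
distribution, is `v_K`. -/
def IsWeakDbar {n q : ℕ} (u : AntiHolForm n q) (v : AntiHolForm n (q + 1)) : Prop :=
  LocallyIntegrable u volume ∧ LocallyIntegrable v volume ∧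
    ∀ (K : MultiIndex n (q + 1)) (φ : ComplexSpace n → ℂ),
      ContDiff ℝ ∞ φ → HasCompactSupport φ →
        ∑ k : {k : Fin n // k ∈ K.1},
            K.sign k * ∫ z, u z (K.erase k) * wirtingerBar k.1 φ z
          = -∫ z, v z K * φ z

/-- The form `v` is `∂̄`-closed: `∂̄v = 0` in the sense of distributions. -/
def IsDbarClosed {n q : ℕ} (v : AntiHolForm n q) : Prop :=
  IsWeakDbar v (0 : AntiHolForm n (q + 1))

/-- The Hardy-type inequality `∫ φ² w ≤ ∫ |∇φ|²` for all real-valued smooth functions `φ` with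
compact support in `ℂⁿ`; `∇` is the gradient on `ℂⁿ = ℝ²ⁿ`. -/
def HardyInequality {n : ℕ} (w : ComplexSpace n → ℝ≥0∞) : Prop :=
  ∀ φ : ComplexSpace n → ℝ, ContDiff ℝ ∞ φ → HasCompactSupport φ →
    ∫⁻ z, ENNReal.ofReal (φ z ^ 2) * w z ≤ ∫⁻ z, ENNReal.ofReal (‖∇ φ z‖ ^ 2)

end

open Filter
open scoped SchwartzMap LineDeriv ComplexConjugate FourierTransform Topology

noncomputable section

/-! ### Exterior and interior multiplication on families indexed by multi-indices -/

/-! The proof is by duality for the Dirac operator `D = ∂̄ + ∂̄*`, acting on forms of all degrees at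
once. On families of Schwartz functions `∂̄² = ∂̄*² = 0`, so `D² = ∂̄∂̄* + ∂̄*∂̄ = -¼Δ`, coefficient
by coefficient (`formDbar_formDbarAdj_add`). As `D` is symmetric, `‖Df‖² = ¼‖∇f‖²`
(`sum_norm_sq_formDirac`), and the Hardy inequality, applied to the real and imaginary parts of each
coefficient, gives `∫ |f|² w ≤ 4‖Df‖²`. Weighted Cauchy–Schwarz then yields `|⟨v, f⟩| ≤ 2 (∫
|v|²/w)^{1/2} ‖Df‖` (`norm_sum_inner_le`).

Riesz representation (`exists_inner_eq_of_norm_le`) provides a square-integrable `U` of mixed degree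
with `⟨U, Df⟩ = ⟨v, f⟩` for all Schwartz `f` and `‖U‖² ≤ 4 ∫ |v|²/w`; that is, `DU = v` weakly. With
`v` of degree `q + 1`, this says `∂̄U_q + ∂̄*U_{q+2} = v` in that degree, so the unwanted term must
be removed. Testing against `f = Dg`, with `g` of degree `q + 2`, and using `∂̄v = 0` shows that
`U_{q+2}` is harmonic; a harmonic `L²` function vanishes by the Fourier transform
(`eq_zero_of_inner_laplacian_eq_zero`). Hence `u = U_q` solves `∂̄u = v`, and dropping the other
components only decreases the norm.

Estimating by `‖Df‖` for every Schwartz `f` avoids any density argument in the domains of `∂̄` and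
`∂̄*`. -/

/-- The sign `ε` with `dz̄_k ∧ dz̄_{K \ {k}} = ε dz̄_K`. -/
def wedgeSign {n : ℕ} (k : Fin n) (K : Finset (Fin n)) : ℂ :=
  (-1) ^ (K.filter (fun l => l < k)).card

lemma wedgeSign_mul_self {n : ℕ} (k : Fin n) (K : Finset (Fin n)) :
    wedgeSign k K * wedgeSign k K = 1 := by
  rw [wedgeSign, ← mul_pow]; simp

lemma conj_wedgeSign {n : ℕ} (k : Fin n) (K : Finset (Fin n)) :
    conj (wedgeSign k K) = wedgeSign k K := by
  simp [wedgeSign]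

lemma wedgeSign_insert {n : ℕ} (k l : Fin n) (K : Finset (Fin n)) (hl : l ∉ K) :
    wedgeSign k (insert l K) = (if l < k then -1 else 1) * wedgeSign k K := by
  unfold wedgeSign
  rw [Finset.filter_insert]
  split_ifs with h
  · rw [Finset.card_insert_of_notMem (by simp [hl]), pow_succ]; ring
  · simp

lemma wedgeSign_erase {n : ℕ} (k l : Fin n) (K : Finset (Fin n)) (hl : l ∈ K) :
    wedgeSign k (K.erase l) = (if l < k then -1 else 1) * wedgeSign k K := by
  have h := wedgeSign_insert k l (K.erase l) (Finset.notMem_erase l K)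
  rw [Finset.insert_erase hl] at h
  rw [h, ← mul_assoc]
  split_ifs <;> simp

section Module

variable {n : ℕ} {M N : Type*} [AddCommGroup M] [Module ℂ M] [AddCommGroup N] [Module ℂ N]

/-- Exterior multiplication by `dz̄_k`. -/
def wedge (k : Fin n) : (Finset (Fin n) → M) →ₗ[ℂ] (Finset (Fin n) → M) where
  toFun c K := if k ∈ K then wedgeSign k K • c (K.erase k) else 0
  map_add' c d := by ext K; simp only [Pi.add_apply]; split_ifs <;> simp
  map_smul' a c := by
    ext K; simp only [Pi.smul_apply, RingHom.id_apply]; split_ifs <;> simp [smul_comm a]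

/-- Interior multiplication by `dz̄_k`. -/
def contract (k : Fin n) : (Finset (Fin n) → M) →ₗ[ℂ] (Finset (Fin n) → M) where
  toFun c K := if k ∈ K then 0 else wedgeSign k K • c (insert k K)
  map_add' c d := by ext K; simp only [Pi.add_apply]; split_ifs <;> simp
  map_smul' a c := by
    ext K; simp only [Pi.smul_apply, RingHom.id_apply]; split_ifs <;> simp [smul_comm a]

lemma wedge_apply (k : Fin n) (c : Finset (Fin n) → M) (K : Finset (Fin n)) :
    wedge k c K = if k ∈ K then wedgeSign k K • c (K.erase k) else 0 := rfl

lemma contract_apply (k : Fin n) (c : Finset (Fin n) → M) (K : Finset (Fin n)) :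
    contract k c K = if k ∈ K then 0 else wedgeSign k K • c (insert k K) := rfl

lemma wedge_map (k : Fin n) (T : M →ₗ[ℂ] N) (c : Finset (Fin n) → M) :
    wedge k (fun K => T (c K)) = fun K => T (wedge k c K) := by
  ext K; simp only [wedge_apply]; split_ifs <;> simp

lemma contract_map (k : Fin n) (T : M →ₗ[ℂ] N) (c : Finset (Fin n) → M) :
    contract k (fun K => T (c K)) = fun K => T (contract k c K) := by
  ext K; simp only [contract_apply]; split_ifs <;> simp

lemma wedge_wedge (k l : Fin n) (c : Finset (Fin n) → M) :
    wedge k (wedge l c) = - wedge l (wedge k c) := by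
  ext K
  simp only [wedge_apply, Pi.neg_apply]
  rcases eq_or_ne k l with rfl | hkl
  · simp
  by_cases hk : k ∈ K <;> by_cases hl : l ∈ K <;> simp only [hk, hl, if_true, if_false,
    Finset.mem_erase, ne_eq, hkl, hkl.symm, not_false_eq_true, and_true, and_false,
    smul_zero, neg_zero]
  rw [wedgeSign_erase l k K hk, wedgeSign_erase k l K hl, smul_smul, smul_smul,
    Finset.erase_right_comm, ← neg_smul]
  congr 1
  rcases lt_or_gt_of_ne hkl with h | h <;> simp [h, h.not_gt] <;> ring

lemma contract_contract (k l : Fin n) (c : Finset (Fin n) → M) :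
    contract k (contract l c) = - contract l (contract k c) := by
  ext K
  simp only [contract_apply, Pi.neg_apply]
  rcases eq_or_ne k l with rfl | hkl
  · simp
  by_cases hk : k ∈ K <;> by_cases hl : l ∈ K <;> simp only [hk, hl, if_true, if_false,
    Finset.mem_insert, hkl, hkl.symm, or_false, or_true, smul_zero, neg_zero]
  rw [wedgeSign_insert l k K hk, wedgeSign_insert k l K hl, smul_smul, smul_smul,
    Finset.insert_comm, ← neg_smul]
  congr 1
  rcases lt_or_gt_of_ne hkl with h | h <;> simp [h, h.not_gt] <;> ring

/-- The Clifford relation. For `k = l` exactly one of the two terms is nonzero, according to whether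
`k ∈ K`; for `k ≠ l` the two signs are opposite because exactly one of `l < k`, `k < l` holds. -/
lemma wedge_contract_add (k l : Fin n) (c : Finset (Fin n) → M) :
    wedge k (contract l c) + contract l (wedge k c) = if k = l then c else 0 := by
  ext K
  simp only [contract_apply, wedge_apply, Pi.add_apply]
  rcases eq_or_ne k l with rfl | hkl
  · by_cases hk : k ∈ K
    · simp [hk, wedgeSign_erase, smul_smul, wedgeSign_mul_self]
    · simp [hk, wedgeSign_insert, smul_smul, wedgeSign_mul_self]
  by_cases hk : k ∈ K <;> by_cases hl : l ∈ K <;> simp only [hk, hl, if_true, if_false,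
    Finset.mem_insert, Finset.mem_erase, ne_eq, hkl, hkl.symm, not_false_eq_true, and_true,
    and_false, or_false, or_true, smul_zero, add_zero, Pi.zero_apply]
  rw [wedgeSign_erase l k K hk, wedgeSign_insert k l K hl, smul_smul, smul_smul,
    Finset.erase_insert_of_ne hkl.symm, ← add_smul]
  convert zero_smul ℂ _
  rcases lt_or_gt_of_ne hkl with h | h <;> simp [h, h.not_gt] <;> ring

end Module

lemma sum_inner_wedge {n : ℕ} {H : Type*} [NormedAddCommGroup H] [InnerProductSpace ℂ H]
    (k : Fin n) (f g : Finset (Fin n) → H) :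
    ∑ K, inner ℂ (wedge k f K) (g K) = ∑ J, inner ℂ (f J) (contract k g J) := by
  have h1 : ∀ K, inner ℂ (wedge k f K) (g K)
      = if k ∈ K then wedgeSign k K * inner ℂ (f (K.erase k)) (g K) else 0 := by
    intro K
    rw [wedge_apply]; split_ifs <;> simp [conj_wedgeSign, mul_comm]
  have h2 : ∀ J, inner ℂ (f J) (contract k g J)
      = if k ∉ J then wedgeSign k J * inner ℂ (f J) (g (insert k J)) else 0 := by
    intro J
    rw [contract_apply]; split_ifs <;> simp_all
  simp_rw [h1, h2]
  rw [← Finset.sum_filter, ← Finset.sum_filter]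
  -- Erasing and inserting `k` are inverse bijections between the sets that contain `k` and those
  -- that do not.
  refine Finset.sum_bij' (fun K _ => K.erase k) (fun J _ => insert k J) ?_ ?_ ?_ ?_ ?_
  · intro K hK; simp
  · intro K hK; simp
  · intro K hK; exact Finset.insert_erase (by simpa using hK)
  · intro K hK; exact Finset.erase_insert (by simpa using hK)
  · intro K hK
    have hK : k ∈ K := by simpa using hK
    rw [wedgeSign_erase k k K hK, Finset.insert_erase hK]; simp

/-! ### Wirtinger derivatives of Schwartz functions -/

section Operators

variable {n : ℕ}

/-- `∂/∂z̄_k` on Schwartz functions. -/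
def schwartzDbar (k : Fin n) : 𝓢(ComplexSpace n, ℂ) →ₗ[ℂ] 𝓢(ComplexSpace n, ℂ) :=
  (1 / 2 : ℂ) • ((LineDeriv.lineDerivOpCLM ℂ 𝓢(ComplexSpace n, ℂ) (EuclideanSpace.single k (1 : ℂ))
    : 𝓢(ComplexSpace n, ℂ) →ₗ[ℂ] 𝓢(ComplexSpace n, ℂ))
    + Complex.I • (LineDeriv.lineDerivOpCLM ℂ 𝓢(ComplexSpace n, ℂ)
      (EuclideanSpace.single k Complex.I) : 𝓢(ComplexSpace n, ℂ) →ₗ[ℂ] 𝓢(ComplexSpace n, ℂ)))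

/-- `∂/∂z_k` on Schwartz functions. -/
def schwartzDz (k : Fin n) : 𝓢(ComplexSpace n, ℂ) →ₗ[ℂ] 𝓢(ComplexSpace n, ℂ) :=
  (1 / 2 : ℂ) • ((LineDeriv.lineDerivOpCLM ℂ 𝓢(ComplexSpace n, ℂ) (EuclideanSpace.single k (1 : ℂ))
    : 𝓢(ComplexSpace n, ℂ) →ₗ[ℂ] 𝓢(ComplexSpace n, ℂ))
    - Complex.I • (LineDeriv.lineDerivOpCLM ℂ 𝓢(ComplexSpace n, ℂ)
      (EuclideanSpace.single k Complex.I) : 𝓢(ComplexSpace n, ℂ) →ₗ[ℂ] 𝓢(ComplexSpace n, ℂ)))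

lemma schwartzDbar_eq (k : Fin n) (f : 𝓢(ComplexSpace n, ℂ)) :
    schwartzDbar k f = (1 / 2 : ℂ) • (∂_{EuclideanSpace.single k (1 : ℂ)} f
      + Complex.I • ∂_{EuclideanSpace.single k Complex.I} f) := rfl

lemma schwartzDz_eq (k : Fin n) (f : 𝓢(ComplexSpace n, ℂ)) :
    schwartzDz k f = (1 / 2 : ℂ) • (∂_{EuclideanSpace.single k (1 : ℂ)} f
      - Complex.I • ∂_{EuclideanSpace.single k Complex.I} f) := rfl

lemma lineDerivOp_comm (f : 𝓢(ComplexSpace n, ℂ)) (a b : ComplexSpace n) :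
    ∂_{a} (∂_{b} f) = ∂_{b} (∂_{a} f) := by
  have key : ∀ (a b z : ComplexSpace n), ∂_{a} (∂_{b} f) z = fderiv ℝ (fderiv ℝ f) z a b := by
    intro a b z
    rw [SchwartzMap.lineDerivOp_apply_eq_fderiv]
    have h : ((∂_{b} f : 𝓢(ComplexSpace n, ℂ)) : ComplexSpace n → ℂ) = fun x => fderiv ℝ f x b := by
      ext x; rw [SchwartzMap.lineDerivOp_apply_eq_fderiv]
    have hd : DifferentiableAt ℝ (fderiv ℝ f) z :=
      ((f.smooth 2).fderiv_right (m := 1) (by norm_num)).differentiable (by norm_num) z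
    rw [h, fderiv_clm_apply hd (differentiableAt_const b)]
    simp
  ext z
  rw [key, key]
  exact ((f.smooth 2).contDiffAt.isSymmSndFDerivAt (by simp)) a b

lemma schwartz_lineDeriv_add (f g : 𝓢(ComplexSpace n, ℂ)) (a : ComplexSpace n) :
    ∂_{a} (f + g) = ∂_{a} f + ∂_{a} g := LineDeriv.lineDerivOp_add a f g

lemma schwartz_lineDeriv_sub (f g : 𝓢(ComplexSpace n, ℂ)) (a : ComplexSpace n) :
    ∂_{a} (f - g) = ∂_{a} f - ∂_{a} g := map_sub (LineDeriv.lineDerivOpCLM ℂ _ a) f g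

lemma schwartz_lineDeriv_smul (c : ℂ) (f : 𝓢(ComplexSpace n, ℂ)) (a : ComplexSpace n) :
    ∂_{a} (c • f) = c • ∂_{a} f := map_smul (LineDeriv.lineDerivOpCLM ℂ _ a) c f

lemma schwartzDbar_comm (k l : Fin n) (f : 𝓢(ComplexSpace n, ℂ)) :
    schwartzDbar k (schwartzDbar l f) = schwartzDbar l (schwartzDbar k f) := by
  simp only [schwartzDbar_eq, schwartz_lineDeriv_add,
    schwartz_lineDeriv_smul]
  rw [lineDerivOp_comm _ (EuclideanSpace.single l 1) (EuclideanSpace.single k 1),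
    lineDerivOp_comm _ (EuclideanSpace.single l Complex.I) (EuclideanSpace.single k Complex.I),
    lineDerivOp_comm _ (EuclideanSpace.single l 1) (EuclideanSpace.single k Complex.I),
    lineDerivOp_comm _ (EuclideanSpace.single l Complex.I) (EuclideanSpace.single k 1)]
  module

lemma schwartzDz_comm (k l : Fin n) (f : 𝓢(ComplexSpace n, ℂ)) :
    schwartzDz k (schwartzDz l f) = schwartzDz l (schwartzDz k f) := by
  simp only [schwartzDz_eq, schwartz_lineDeriv_sub, schwartz_lineDeriv_smul]
  rw [lineDerivOp_comm _ (EuclideanSpace.single l 1) (EuclideanSpace.single k 1),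
    lineDerivOp_comm _ (EuclideanSpace.single l Complex.I) (EuclideanSpace.single k Complex.I),
    lineDerivOp_comm _ (EuclideanSpace.single l 1) (EuclideanSpace.single k Complex.I),
    lineDerivOp_comm _ (EuclideanSpace.single l Complex.I) (EuclideanSpace.single k 1)]
  module

lemma schwartzDbar_schwartzDz_comm (k l : Fin n) (f : 𝓢(ComplexSpace n, ℂ)) :
    schwartzDbar k (schwartzDz l f) = schwartzDz l (schwartzDbar k f) := by
  simp only [schwartzDz_eq, schwartzDbar_eq, schwartz_lineDeriv_sub, schwartz_lineDeriv_add,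
    schwartz_lineDeriv_smul]
  rw [lineDerivOp_comm _ (EuclideanSpace.single l 1) (EuclideanSpace.single k 1),
    lineDerivOp_comm _ (EuclideanSpace.single l Complex.I) (EuclideanSpace.single k Complex.I),
    lineDerivOp_comm _ (EuclideanSpace.single l 1) (EuclideanSpace.single k Complex.I),
    lineDerivOp_comm _ (EuclideanSpace.single l Complex.I) (EuclideanSpace.single k 1)]
  module

lemma schwartzDbar_schwartzDz_self (k : Fin n) (f : 𝓢(ComplexSpace n, ℂ)) :
    schwartzDbar k (schwartzDz k f) = (1 / 4 : ℂ) •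
      (∂_{EuclideanSpace.single k (1 : ℂ)} (∂_{EuclideanSpace.single k (1 : ℂ)} f)
      + ∂_{EuclideanSpace.single k Complex.I} (∂_{EuclideanSpace.single k Complex.I} f)) := by
  simp only [schwartzDz_eq, schwartzDbar_eq, schwartz_lineDeriv_sub, schwartz_lineDeriv_smul]
  rw [lineDerivOp_comm _ (EuclideanSpace.single k 1) (EuclideanSpace.single k Complex.I)]
  match_scalars <;> ring_nf
  simp; norm_num

/-! ### The operators `∂̄` and `∂̄*` on families of Schwartz functions -/

/-- `∂̄ = ∑ dz̄_k ∧ ∂/∂z̄_k`. -/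
def formDbar : (Finset (Fin n) → 𝓢(ComplexSpace n, ℂ)) →ₗ[ℂ]
    (Finset (Fin n) → 𝓢(ComplexSpace n, ℂ)) :=
  ∑ k, wedge k ∘ₗ (schwartzDbar k).compLeft (Finset (Fin n))

/-- The formal adjoint `∂̄*` of `∂̄`. -/
def formDbarAdj : (Finset (Fin n) → 𝓢(ComplexSpace n, ℂ)) →ₗ[ℂ]
    (Finset (Fin n) → 𝓢(ComplexSpace n, ℂ)) :=
  -∑ k, contract k ∘ₗ (schwartzDz k).compLeft (Finset (Fin n))

lemma formDbar_apply (f : Finset (Fin n) → 𝓢(ComplexSpace n, ℂ)) :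
    formDbar f = ∑ k, wedge k (fun K => schwartzDbar k (f K)) := by
  simp [formDbar]; rfl

lemma formDbarAdj_apply (f : Finset (Fin n) → 𝓢(ComplexSpace n, ℂ)) :
    formDbarAdj f = -∑ k, contract k (fun K => schwartzDz k (f K)) := by
  simp [formDbarAdj]; rfl

lemma eq_zero_of_eq_neg {M : Type*} [AddCommGroup M] [Module ℂ M] {x : M} (h : x = -x) :
    x = 0 := by
  have h2 : (2 : ℂ) • x = 0 := by rw [two_smul]; nth_rewrite 1 [h]; simp
  simpa using h2

lemma formDbar_formDbar (f : Finset (Fin n) → 𝓢(ComplexSpace n, ℂ)) :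
    formDbar (formDbar f) = 0 := by
  have h : formDbar (formDbar f)
      = ∑ k, ∑ l, wedge k (wedge l fun K => schwartzDbar k (schwartzDbar l (f K))) := by
    rw [formDbar_apply]
    refine Finset.sum_congr rfl fun k _ => ?_
    rw [← map_sum]
    congr 1
    ext1 K
    simp only [formDbar_apply, Finset.sum_apply, map_sum]
    exact Finset.sum_congr rfl fun l _ => (congrFun (wedge_map l (schwartzDbar k) _) K).symm
  apply eq_zero_of_eq_neg
  -- Exchanging `k` and `l` changes the sign of the double sum: the derivatives commute and the
  -- exterior factors anticommute.
  conv_lhs => rw [h, Finset.sum_comm]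
  rw [h, ← Finset.sum_neg_distrib]
  refine Finset.sum_congr rfl fun k _ => ?_
  rw [← Finset.sum_neg_distrib]
  refine Finset.sum_congr rfl fun l _ => ?_
  rw [wedge_wedge]
  simp_rw [schwartzDbar_comm l k]

lemma formDbarAdj_formDbarAdj (f : Finset (Fin n) → 𝓢(ComplexSpace n, ℂ)) :
    formDbarAdj (formDbarAdj f) = 0 := by
  have h : formDbarAdj (formDbarAdj f)
      = ∑ k, ∑ l, contract k (contract l fun K => schwartzDz k (schwartzDz l (f K))) := by
    rw [formDbarAdj_apply f, map_neg, formDbarAdj_apply, neg_neg]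
    refine Finset.sum_congr rfl fun k _ => ?_
    rw [← map_sum]
    congr 1
    ext1 K
    simp only [Finset.sum_apply, map_sum]
    exact Finset.sum_congr rfl fun l _ => (congrFun (contract_map l (schwartzDz k) _) K).symm
  apply eq_zero_of_eq_neg
  conv_lhs => rw [h, Finset.sum_comm]
  rw [h, ← Finset.sum_neg_distrib]
  refine Finset.sum_congr rfl fun k _ => ?_
  rw [← Finset.sum_neg_distrib]
  refine Finset.sum_congr rfl fun l _ => ?_
  rw [contract_contract]
  simp_rw [schwartzDz_comm l k]

/-- The terms with `k ≠ l` cancel by the Clifford relation `wedge_contract_add`, since the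
constant-coefficient operators `∂/∂z̄_k` and `∂/∂z_l` commute. What remains is `-¼Δ` on each
coefficient, with no coupling between coefficients. -/
lemma formDbar_formDbarAdj_add (f : Finset (Fin n) → 𝓢(ComplexSpace n, ℂ)) :
    formDbar (formDbarAdj f) + formDbarAdj (formDbar f)
      = fun K => -∑ k, schwartzDbar k (schwartzDz k (f K)) := by
  have h1 : formDbar (formDbarAdj f)
      = -∑ k, ∑ l, wedge k (contract l fun K => schwartzDbar k (schwartzDz l (f K))) := by
    rw [formDbarAdj_apply f, map_neg, formDbar_apply]
    congr 1
    refine Finset.sum_congr rfl fun k _ => ?_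
    rw [← map_sum]
    congr 1
    ext1 K
    simp only [Finset.sum_apply, map_sum]
    exact Finset.sum_congr rfl fun l _ => (congrFun (contract_map l (schwartzDbar k) _) K).symm
  have h2 : formDbarAdj (formDbar f)
      = -∑ l, ∑ k, contract l (wedge k fun K => schwartzDbar k (schwartzDz l (f K))) := by
    rw [formDbarAdj_apply, formDbar_apply f]
    congr 1
    refine Finset.sum_congr rfl fun l _ => ?_
    rw [← map_sum]
    congr 1
    ext1 K
    simp only [Finset.sum_apply, map_sum, schwartzDbar_schwartzDz_comm]
    exact Finset.sum_congr rfl fun k _ => (congrFun (wedge_map k (schwartzDz l) _) K).symm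
  rw [h1, h2, Finset.sum_comm (f := fun l k => contract l _), ← neg_add,
    ← Finset.sum_add_distrib]
  simp_rw [← Finset.sum_add_distrib, wedge_contract_add]
  ext1 K
  simp

end Operators

/-! ### Integration by parts, the energy identity, and harmonic functions in `L²` -/

section L2

variable {n : ℕ}

/-- The inclusion of the Schwartz functions into `L²(ℂⁿ)`. -/
abbrev schwartzL2 (n : ℕ) : 𝓢(ComplexSpace n, ℂ) →ₗ[ℂ] Lp ℂ 2 (volume : Measure (ComplexSpace n)) :=
  (SchwartzMap.toLpCLM ℂ ℂ 2 volume : 𝓢(ComplexSpace n, ℂ) →L[ℂ] Lp ℂ 2 volume)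

lemma inner_schwartzL2 (f g : 𝓢(ComplexSpace n, ℂ)) :
    inner ℂ (schwartzL2 n f) (schwartzL2 n g) = ∫ z, inner ℂ (f z) (g z) :=
  SchwartzMap.inner_toL2_toL2_eq f g

lemma inner_lineDeriv (f g : 𝓢(ComplexSpace n, ℂ)) (m : ComplexSpace n) :
    inner ℂ (schwartzL2 n (∂_{m} f)) (schwartzL2 n g)
      = -inner ℂ (schwartzL2 n f) (schwartzL2 n (∂_{m} g)) := by
  have h := SchwartzMap.integral_bilinear_lineDerivOp_right_eq_neg_left (μ := volume) f g
    ((ContinuousLinearMap.mul ℝ ℂ).comp (Complex.conjCLE : ℂ →L[ℝ] ℂ)) m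
  rw [inner_schwartzL2, inner_schwartzL2]
  simp only [ContinuousLinearMap.comp_apply, ContinuousLinearMap.mul_apply',
    ContinuousLinearEquiv.coe_coe, Complex.conjCLE_apply] at h
  simp only [RCLike.inner_apply, mul_comm (g _), mul_comm ((∂_{m} g : 𝓢(ComplexSpace n, ℂ)) _)]
  rw [h, neg_neg]

lemma inner_schwartzDbar (k : Fin n) (f g : 𝓢(ComplexSpace n, ℂ)) :
    inner ℂ (schwartzL2 n (schwartzDbar k f)) (schwartzL2 n g)
      = -inner ℂ (schwartzL2 n f) (schwartzL2 n (schwartzDz k g)) := by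
  rw [schwartzDbar_eq, schwartzDz_eq]
  simp only [map_smul, map_add, map_sub, inner_smul_left, inner_smul_right, inner_add_left,
    inner_sub_right, inner_lineDeriv, map_div₀, map_one, map_ofNat, Complex.conj_I]
  ring

lemma sum_inner_formDbar (f g : Finset (Fin n) → 𝓢(ComplexSpace n, ℂ)) :
    ∑ K, inner ℂ (schwartzL2 n (formDbar f K)) (schwartzL2 n (g K))
      = ∑ K, inner ℂ (schwartzL2 n (f K)) (schwartzL2 n (formDbarAdj g K)) := by
  simp only [formDbar_apply, formDbarAdj_apply, Finset.sum_apply, Pi.neg_apply, map_sum, map_neg,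
    sum_inner, inner_sum, inner_neg_right]
  rw [Finset.sum_comm, Finset.sum_neg_distrib, Finset.sum_comm (s := Finset.univ (α := Finset _)),
    ← Finset.sum_neg_distrib]
  refine Finset.sum_congr rfl fun k _ => ?_
  have h1 := wedge_map k (schwartzL2 n) (fun K => schwartzDbar k (f K))
  have h2 := contract_map k (schwartzL2 n) g
  have h := sum_inner_wedge k (fun K => schwartzL2 n (schwartzDbar k (f K)))
    (fun K => schwartzL2 n (g K))
  rw [h1, h2] at h
  rw [h, ← Finset.sum_neg_distrib]
  refine Finset.sum_congr rfl fun J _ => ?_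
  rw [inner_schwartzDbar, contract_map k (schwartzDz k) g]

lemma sum_inner_formDbarAdj_left (f g : Finset (Fin n) → 𝓢(ComplexSpace n, ℂ)) :
    ∑ K, inner ℂ (schwartzL2 n (formDbarAdj f K)) (schwartzL2 n (g K))
      = ∑ K, inner ℂ (schwartzL2 n (f K)) (schwartzL2 n (formDbar g K)) := by
  have h := congrArg conj (sum_inner_formDbar g f)
  simp only [map_sum, inner_conj_symm] at h
  exact h.symm

/-- Here `U` is merely square-integrable, so all derivatives stay on `g`; only the algebraic
adjunction between `wedge` and `contract` is used. The right-hand side is the weak form of `∂̄U`. -/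
lemma sum_inner_formDbarAdj (U : Finset (Fin n) → Lp ℂ 2 (volume : Measure (ComplexSpace n)))
    (g : Finset (Fin n) → 𝓢(ComplexSpace n, ℂ)) :
    ∑ J, inner ℂ (U J) (schwartzL2 n (formDbarAdj g J))
      = -∑ K, ∑ k, inner ℂ (wedge k U K) (schwartzL2 n (schwartzDz k (g K))) := by
  simp only [formDbarAdj_apply, Finset.sum_apply, Pi.neg_apply, map_sum, map_neg,
    inner_sum, inner_neg_right]
  rw [Finset.sum_neg_distrib]
  congr 1
  rw [Finset.sum_comm]
  conv_rhs => rw [Finset.sum_comm]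
  refine Finset.sum_congr rfl fun k _ => ?_
  have h := sum_inner_wedge k U (fun K => schwartzL2 n (schwartzDz k (g K)))
  rw [contract_map] at h
  exact h.symm

/-- The Dirac operator `∂̄ + ∂̄*`. -/
def formDirac : (Finset (Fin n) → 𝓢(ComplexSpace n, ℂ)) →ₗ[ℂ]
    (Finset (Fin n) → 𝓢(ComplexSpace n, ℂ)) := formDbar + formDbarAdj

/-- `D` is symmetric and `D² = -¼Δ`, so `‖Df‖² = ⟨f, D²f⟩`; one integration by parts in each real
direction turns this into `¼‖∇f‖²`. The factor `¼` is the source of the constant `4` in the theorem.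
-/
lemma sum_norm_sq_formDirac (f : Finset (Fin n) → 𝓢(ComplexSpace n, ℂ)) :
    ∑ K, ‖schwartzL2 n (formDirac f K)‖ ^ 2 = (1 / 4) * ∑ K : Finset (Fin n), ∑ k : Fin n,
      (‖schwartzL2 n (∂_{EuclideanSpace.single k (1 : ℂ)} (f K))‖ ^ 2
        + ‖schwartzL2 n (∂_{EuclideanSpace.single k Complex.I} (f K))‖ ^ 2) := by
  have hD : formDirac (formDirac f) = fun K => -∑ k, schwartzDbar k (schwartzDz k (f K)) := by
    rw [← formDbar_formDbarAdj_add]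
    simp [formDirac, formDbar_formDbar, formDbarAdj_formDbarAdj]
  have h1 : ∑ K, inner ℂ (schwartzL2 n (formDirac f K)) (schwartzL2 n (formDirac f K))
      = ∑ K, inner ℂ (schwartzL2 n (f K)) (schwartzL2 n (formDirac (formDirac f) K)) := by
    have ha := sum_inner_formDbar f (formDirac f)
    have hb := sum_inner_formDbarAdj_left f (formDirac f)
    have e1 : ∀ g : Finset (Fin n) → 𝓢(ComplexSpace n, ℂ), ∀ K,
        formDirac g K = formDbar g K + formDbarAdj g K := fun _ _ => rfl
    conv_lhs => enter [2, K]; rw [e1 f K, map_add, inner_add_left, ← map_add, ← e1 f K]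
    conv_rhs => enter [2, K]; rw [e1 (formDirac f) K, map_add, inner_add_right]
    rw [Finset.sum_add_distrib, Finset.sum_add_distrib, ha, hb, add_comm]
  have h2 : ∀ (m : ComplexSpace n) (g : 𝓢(ComplexSpace n, ℂ)),
      inner ℂ (schwartzL2 n g) (schwartzL2 n (∂_{m} (∂_{m} g)))
        = -((‖schwartzL2 n (∂_{m} g)‖ ^ 2 : ℝ) : ℂ) := by
    intro m g
    have := inner_lineDeriv g (∂_{m} g) m
    rw [inner_self_eq_norm_sq_to_K] at this
    rw [← neg_eq_iff_eq_neg, ← this]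
    simp
  rw [hD] at h1
  simp only [schwartzDbar_schwartzDz_self, map_neg, map_sum, map_smul, map_add, inner_neg_right,
    inner_sum, inner_smul_right, inner_add_right, h2] at h1
  simp only [inner_self_eq_norm_sq_to_K] at h1
  apply Complex.ofReal_injective
  push_cast
  refine Eq.trans ?_ (h1.trans ?_)
  · rfl
  · rw [Finset.mul_sum]
    refine Finset.sum_congr rfl fun K _ => ?_
    rw [Finset.mul_sum, ← Finset.sum_neg_distrib]
    refine Finset.sum_congr rfl fun k _ => ?_
    push_cast
    ring

lemma real_inner_single (ξ : ComplexSpace n) (k : Fin n) (c : ℂ) :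
    inner ℝ ξ (EuclideanSpace.single k c) = inner ℝ (ξ k) c := by
  rw [PiLp.inner_apply, Finset.sum_eq_single k]
  · simp
  · intro b _ hb; simp [hb]
  · simp

lemma norm_sq_eq_sum_real_inner (ξ : ComplexSpace n) :
    ‖ξ‖ ^ 2 = ∑ k, (inner ℝ ξ (EuclideanSpace.single k (1 : ℂ)) ^ 2
      + inner ℝ ξ (EuclideanSpace.single k Complex.I) ^ 2) := by
  rw [EuclideanSpace.norm_sq_eq]
  refine Finset.sum_congr rfl fun k _ => ?_
  rw [real_inner_single, real_inner_single, Complex.inner, Complex.inner, Complex.sq_norm,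
    Complex.normSq_apply]
  simp
  ring

lemma fourier_lineDeriv_lineDeriv (f : 𝓢(ComplexSpace n, ℂ)) (m ξ : ComplexSpace n) :
    𝓕 (∂_{m} (∂_{m} f)) ξ = -(4 * Real.pi ^ 2 : ℂ) * (inner ℝ ξ m : ℂ) ^ 2 * 𝓕 f ξ := by
  have ht : Function.HasTemperateGrowth (fun x : ComplexSpace n => inner ℝ x m) := by fun_prop
  rw [SchwartzMap.fourier_lineDerivOp_eq, SchwartzMap.fourier_lineDerivOp_eq]
  simp only [_root_.smul_apply, SchwartzMap.smulLeftCLM_apply_apply ht, smul_eq_mul,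
    Complex.real_smul]
  ring_nf
  simp

/-- Each real derivative in direction `m` becomes multiplication by `2πi⟨ξ, m⟩`, so `¼Δ` has symbol
`-¼ · 4π²|ξ|²`. -/
lemma fourier_sum_schwartzDbar_schwartzDz (f : 𝓢(ComplexSpace n, ℂ)) (ξ : ComplexSpace n) :
    𝓕 (∑ k, schwartzDbar k (schwartzDz k f)) ξ
      = -(Real.pi ^ 2 : ℂ) * (‖ξ‖ : ℂ) ^ 2 * 𝓕 f ξ := by
  have h : 𝓕 (∑ k, schwartzDbar k (schwartzDz k f))
      = ∑ k, 𝓕 (schwartzDbar k (schwartzDz k f)) :=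
    map_sum (FourierTransform.fourierCLM ℂ 𝓢(ComplexSpace n, ℂ)) _ _
  have h3 : ∀ k ξ, 𝓕 (schwartzDbar k (schwartzDz k f)) ξ = -(Real.pi ^ 2 : ℂ) *
      ((inner ℝ ξ (EuclideanSpace.single k (1 : ℂ)) : ℂ) ^ 2
      + (inner ℝ ξ (EuclideanSpace.single k Complex.I) : ℂ) ^ 2) * 𝓕 f ξ := by
    intro k ξ
    rw [schwartzDbar_schwartzDz_self, FourierTransform.fourier_smul, FourierTransform.fourier_add]
    simp only [_root_.smul_apply, _root_.add_apply, fourier_lineDeriv_lineDeriv,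
      smul_eq_mul]
    ring
  rw [h, _root_.sum_apply]
  simp_rw [h3]
  rw [← Finset.sum_mul, ← Finset.mul_sum]
  congr 2
  have := congrArg (fun x : ℝ => (x : ℂ)) (norm_sq_eq_sum_real_inner ξ)
  push_cast at this
  exact this.symm

/-- A square-integrable function which is harmonic in the sense of distributions vanishes. -/
lemma eq_zero_of_inner_laplacian_eq_zero (hn : 0 < n)
    (a : Lp ℂ 2 (volume : Measure (ComplexSpace n)))
    (ha : ∀ f : 𝓢(ComplexSpace n, ℂ),
      inner ℂ a (schwartzL2 n (∑ k, schwartzDbar k (schwartzDz k f))) = 0) : a = 0 := by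
  have hnt : Nontrivial (ComplexSpace n) := by
    have : NeZero n := ⟨hn.ne'⟩
    infer_instance
  obtain ⟨b, hb⟩ : ∃ b : Lp ℂ 2 (volume : Measure (ComplexSpace n)), b = 𝓕 a := ⟨_, rfl⟩
  have hloc : LocallyIntegrable (fun ξ => ((‖ξ‖ : ℂ) ^ 2) * conj (b ξ))
      (volume : Measure (ComplexSpace n)) := by
    have h1 : LocallyIntegrable (fun ξ => conj (b ξ)) (volume : Measure (ComplexSpace n)) := by
      have := ((Lp.memLp b).star).locallyIntegrable (by norm_num)
      exact this
    rw [← locallyIntegrableOn_univ] at h1 ⊢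
    refine h1.continuousOn_mul ?_ isOpen_univ.isLocallyClosed
    fun_prop
  have h0 : ∀ᵐ ξ : ComplexSpace n, ((‖ξ‖ : ℂ) ^ 2) * conj (b ξ) = 0 := by
    -- Since the Fourier transform preserves the Schwartz space, any test function `g` on the
    -- frequency side is reached by testing the hypothesis against its inverse transform. Plancherel
    -- then gives `∫ g |ξ|² conj b = 0`.
    refine ae_eq_zero_of_integral_contDiff_smul_eq_zero hloc fun g hg hgs => ?_
    have hg' : ContDiff ℝ ∞ (fun ξ => (g ξ : ℂ)) := Complex.ofRealCLM.contDiff.comp hg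
    have hgs' : HasCompactSupport (fun ξ => (g ξ : ℂ)) :=
      hgs.comp_left (g := fun x : ℝ => (x : ℂ)) (by simp)
    obtain ⟨ψ, hψ⟩ : ∃ ψ : 𝓢(ComplexSpace n, ℂ), ∀ ξ, ψ ξ = (g ξ : ℂ) :=
      ⟨hgs'.toSchwartzMap hg', fun _ => rfl⟩
    obtain ⟨F, hF⟩ : ∃ F : 𝓢(ComplexSpace n, ℂ),
        F = ∑ k, schwartzDbar k (schwartzDz k (𝓕⁻ ψ)) := ⟨_, rfl⟩
    have h : inner ℂ a (F.toLp 2) = 0 := by rw [hF]; exact ha (𝓕⁻ ψ)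
    have hFξ : ∀ ξ, 𝓕 F ξ = -(Real.pi ^ 2 : ℂ) * (‖ξ‖ : ℂ) ^ 2 * ψ ξ := by
      intro ξ
      rw [hF, fourier_sum_schwartzDbar_schwartzDz, FourierTransform.fourier_fourierInv_eq]
    rw [← Lp.inner_fourier_eq, SchwartzMap.toLp_fourier_eq, ← hb, L2.inner_def] at h
    have h2 : ∫ ξ, inner ℂ (b ξ) (-(Real.pi ^ 2 : ℂ) * (‖ξ‖ : ℂ) ^ 2 * ψ ξ) = 0 := by
      rw [← h]
      refine integral_congr_ae ?_
      filter_upwards [SchwartzMap.coeFn_toLp (𝓕 F) 2 volume] with ξ hξ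
      rw [hξ, hFξ]
    have h3 : ∀ ξ, inner ℂ (b ξ) (-(Real.pi ^ 2 : ℂ) * (‖ξ‖ : ℂ) ^ 2 * ψ ξ)
        = -(Real.pi ^ 2 : ℂ) * (g ξ • (((‖ξ‖ : ℂ) ^ 2) * conj (b ξ))) := by
      intro ξ
      rw [RCLike.inner_apply, Complex.real_smul, hψ]
      ring
    simp_rw [h3] at h2
    rw [integral_const_mul] at h2
    simpa [Real.pi_ne_zero] using h2
  -- The origin is a null set only because `n > 0`. For `n = 0` the measure is a point mass and the
  -- lemma would fail.
  have hne : ∀ᵐ ξ : ComplexSpace n, ξ ≠ 0 := by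
    simp [ae_iff]
  have hb0 : b = 0 := by
    rw [Lp.eq_zero_iff_ae_eq_zero]
    filter_upwards [h0, hne] with ξ h1 h2
    simpa [h2] using h1
  have : 𝓕⁻ b = 0 := by
    rw [hb0]
    exact map_zero
      (FourierTransform.fourierInvCLM ℂ (Lp ℂ 2 (volume : Measure (ComplexSpace n))))
  rwa [hb, FourierTransform.fourierInv_fourier_eq] at this

end L2

/-! ### Truncation by dilated bump functions -/

section Cutoff

/-- Smooth compactly supported truncations of a smooth function, with control of the first
derivatives. -/
lemma exists_truncation {E F : Type*} [NormedAddCommGroup E] [InnerProductSpace ℝ E]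
    [FiniteDimensional ℝ E] [NormedAddCommGroup F] [NormedSpace ℝ F] {f : E → F}
    (hf : ContDiff ℝ ∞ f) :
    ∃ (φ : ℕ → E → F) (C : ℝ), (∀ j, ContDiff ℝ ∞ (φ j)) ∧ (∀ j, HasCompactSupport (φ j)) ∧
      (∀ j z, ‖φ j z‖ ≤ ‖f z‖) ∧ (∀ j z, ‖fderiv ℝ (φ j) z‖ ≤ ‖fderiv ℝ f z‖ + C * ‖f z‖) ∧
      (∀ z, ∀ᶠ j in atTop, φ j =ᶠ[𝓝 z] f) := by
  let χ : ContDiffBump (0 : E) := ⟨1, 2, one_pos, one_lt_two⟩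
  have hχs : ContDiff ℝ ∞ χ := χ.contDiff
  obtain ⟨C, hC⟩ : ∃ C, ∀ x, ‖fderiv ℝ χ x‖ ≤ C :=
    (hχs.continuous_fderiv (by simp)).bounded_above_of_compact_support
      (χ.hasCompactSupport.fderiv ℝ)
  have hC0 : 0 ≤ C := (norm_nonneg _).trans (hC 0)
  -- The scales are at most `1`, so the dilated cutoffs all inherit the derivative bound `C`; they
  -- tend to `0`, so the cutoffs exhaust the space.
  let r : ℕ → ℝ := fun j => ((j : ℝ) + 1)⁻¹
  have hr : ∀ j, 0 < r j := fun j => by positivity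
  have hr1 : ∀ j, r j ≤ 1 := fun j => inv_le_one_of_one_le₀ (by simp)
  let χr : ℕ → E → ℝ := fun j z => χ (r j • z)
  have hχr : ∀ j, ContDiff ℝ ∞ (χr j) := fun j => hχs.comp (contDiff_const_smul _)
  have hd : ∀ j z, ‖fderiv ℝ (χr j) z‖ ≤ C := by
    intro j z
    have h1 : HasFDerivAt (χr j) ((fderiv ℝ χ (r j • z)).comp
        (r j • ContinuousLinearMap.id ℝ E)) z := by
      refine HasFDerivAt.comp (g := χ) (f := fun z => r j • z) z ?_ ((hasFDerivAt_id z).const_smul (r j))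
      exact (hχs.differentiable (by simp) _).hasFDerivAt
    rw [h1.fderiv, ContinuousLinearMap.comp_smul, ContinuousLinearMap.comp_id, norm_smul,
      Real.norm_of_nonneg (hr j).le]
    calc r j * _ ≤ 1 * C := mul_le_mul (hr1 j) (hC _) (norm_nonneg _) zero_le_one
      _ = C := one_mul C
  refine ⟨fun j z => χr j z • f z, C, fun j => (hχr j).smul hf, fun j => ?_, fun j z => ?_,
    fun j z => ?_, fun z => ?_⟩
  · refine HasCompactSupport.smul_right ?_
    exact χ.hasCompactSupport.comp_homeomorph (Homeomorph.smulOfNeZero (r j) (hr j).ne')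
  · rw [norm_smul, Real.norm_of_nonneg χ.nonneg]
    exact mul_le_of_le_one_left (norm_nonneg _) χ.le_one
  · have hfz := hf.differentiable (by simp) z
    have hχz := (hχr j).differentiable (by simp) z
    rw [fderiv_fun_smul hχz hfz]
    refine (norm_add_le _ _).trans (add_le_add ?_ ?_)
    · rw [norm_smul, Real.norm_of_nonneg χ.nonneg]
      exact mul_le_of_le_one_left (norm_nonneg _) χ.le_one
    · rw [ContinuousLinearMap.norm_smulRight_apply]
      exact mul_le_mul_of_nonneg_right (hd j z) (norm_nonneg _)
  -- Equality near `z`, not just at `z`, is what makes the derivatives agree eventually as well.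
  · have hlim : Tendsto (fun j => ‖r j • z‖) atTop (𝓝 0) := by
      have : Tendsto r atTop (𝓝 0) := by
        simpa [r] using tendsto_one_div_add_atTop_nhds_zero_nat (𝕜 := ℝ)
      simpa using (this.smul_const z).norm
    filter_upwards [hlim.eventually (gt_mem_nhds zero_lt_one)] with j hj
    have hcont : Continuous fun y : E => ‖r j • y‖ := by fun_prop
    filter_upwards [hcont.continuousAt.eventually (gt_mem_nhds hj)] with y hy
    have : χr j y = 1 := χ.one_of_mem_closedBall (by simpa using hy.le)
    simp [this]

end Cutoff

/-! ### Passing from compactly supported test functions to Schwartz functions -/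

section Extension

variable {n : ℕ}

lemma norm_gradient (φ : ComplexSpace n → ℝ) (z : ComplexSpace n) :
    ‖∇ φ z‖ = ‖fderiv ℝ φ z‖ := by
  simp [gradient]

lemma norm_fderiv_sq_eq_sum (φ : ComplexSpace n → ℝ) (z : ComplexSpace n) :
    ‖fderiv ℝ φ z‖ ^ 2 = ∑ k, (fderiv ℝ φ z (EuclideanSpace.single k (1 : ℂ)) ^ 2
      + fderiv ℝ φ z (EuclideanSpace.single k Complex.I) ^ 2) := by
  have h : ∀ m, inner ℝ (∇ φ z) m = fderiv ℝ φ z m := by intro m; simp [gradient]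
  rw [← norm_gradient, norm_sq_eq_sum_real_inner]
  simp only [h]

/-- The Hardy inequality for smooth functions which lie in `H¹`. -/
lemma HardyInequality.of_memLp {w : ComplexSpace n → ℝ≥0∞} (hw : AEMeasurable w volume)
    (h : HardyInequality w) {f : ComplexSpace n → ℝ} (hf : ContDiff ℝ ∞ f)
    (hf2 : MemLp f 2 volume) (hdf : MemLp (fderiv ℝ f) 2 volume) :
    ∫⁻ z, ENNReal.ofReal (f z ^ 2) * w z ≤ ∫⁻ z, ENNReal.ofReal (‖fderiv ℝ f z‖ ^ 2) := by
  obtain ⟨φ, C, hφ, hφs, -, hφd, hφe⟩ := exists_truncation hf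
  have hlim1 : ∀ z, Tendsto (fun j => ENNReal.ofReal (φ j z ^ 2) * w z) atTop
      (𝓝 (ENNReal.ofReal (f z ^ 2) * w z)) := fun z =>
    tendsto_const_nhds.congr' ((hφe z).mono fun j hj => by simp only [hj.eq_of_nhds])
  have hlim2 : Tendsto (fun j => ∫⁻ z, ENNReal.ofReal (‖fderiv ℝ (φ j) z‖ ^ 2)) atTop
      (𝓝 (∫⁻ z, ENNReal.ofReal (‖fderiv ℝ f z‖ ^ 2))) := by
    have hI : Integrable (fun z => (‖fderiv ℝ f z‖ + C * ‖f z‖) ^ 2)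
        (volume : Measure (ComplexSpace n)) :=
      (hdf.norm.add (hf2.norm.const_mul C)).integrable_sq
    refine tendsto_lintegral_of_dominated_convergence
      (fun z => ENNReal.ofReal ((‖fderiv ℝ f z‖ + C * ‖f z‖) ^ 2)) (fun j => ?_) (fun j => ?_)
      ?_ ?_
    · have := (hφ j).continuous_fderiv (by simp)
      exact (by fun_prop : Continuous fun z => ‖fderiv ℝ (φ j) z‖ ^ 2).measurable.ennreal_ofReal
    · exact .of_forall fun z => ENNReal.ofReal_le_ofReal
        (pow_le_pow_left₀ (norm_nonneg _) (hφd j z) 2)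
    · exact hI.lintegral_lt_top.ne
    · exact .of_forall fun z => tendsto_const_nhds.congr'
        ((hφe z).mono fun j hj => by simp only [hj.fderiv_eq])
  -- Fatou's lemma handles the left side, where no integrable majorant is available; the right side
  -- converges by domination.
  calc ∫⁻ z, ENNReal.ofReal (f z ^ 2) * w z
      = ∫⁻ z, liminf (fun j => ENNReal.ofReal (φ j z ^ 2) * w z) atTop :=
        lintegral_congr fun z => (hlim1 z).liminf_eq.symm
    _ ≤ liminf (fun j => ∫⁻ z, ENNReal.ofReal (φ j z ^ 2) * w z) atTop :=
        lintegral_liminf_le' fun j =>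
          (((hφ j).continuous.pow 2).measurable.ennreal_ofReal.aemeasurable).mul hw
    _ ≤ liminf (fun j => ∫⁻ z, ENNReal.ofReal (‖fderiv ℝ (φ j) z‖ ^ 2)) atTop := by
        refine liminf_le_liminf (.of_forall fun j => ?_)
        simpa only [norm_gradient] using h (φ j) (hφ j) (hφs j)
    _ = _ := hlim2.liminf_eq

lemma fderiv_clm_comp_schwartz {F : Type*} [NormedAddCommGroup F] [NormedSpace ℝ F]
    (f : 𝓢(ComplexSpace n, ℂ)) (L : ℂ →L[ℝ] F) (z : ComplexSpace n) :
    fderiv ℝ (fun z => L (f z)) z = L.comp (fderiv ℝ f z) :=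
  (L.hasFDerivAt.comp z (f.differentiableAt).hasFDerivAt).fderiv

lemma memLp_fderiv_clm_comp {F : Type*} [NormedAddCommGroup F] [NormedSpace ℝ F]
    (f : 𝓢(ComplexSpace n, ℂ)) (L : ℂ →L[ℝ] F) :
    MemLp (fderiv ℝ (fun z => L (f z))) 2 (volume : Measure (ComplexSpace n)) := by
  have h : MemLp (fderiv ℝ f) 2 (volume : Measure (ComplexSpace n)) :=
    (SchwartzMap.fderivCLM ℝ (ComplexSpace n) ℂ f).memLp 2 volume
  have h2 := (ContinuousLinearMap.compL ℝ (ComplexSpace n) ℂ F L).comp_memLp' h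
  exact h2.ae_eq (.of_forall fun z => (fderiv_clm_comp_schwartz f L z).symm)

lemma ofReal_norm_toLp_sq {α F : Type*} [MeasurableSpace α] {μ : Measure α}
    [NormedAddCommGroup F] {f : α → F} (hf : MemLp f 2 μ) :
    ENNReal.ofReal (‖hf.toLp f‖ ^ 2) = ∫⁻ z, ‖f z‖ₑ ^ 2 ∂μ := by
  rw [Lp.norm_toLp, ENNReal.ofReal_pow ENNReal.toReal_nonneg,
    ENNReal.ofReal_toReal hf.eLpNorm_ne_top]
  have := eLpNorm_nnreal_pow_eq_lintegral (f := f) (μ := μ) (p := 2) two_ne_zero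
  simpa using this

lemma ofReal_norm_schwartzL2_sq (f : 𝓢(ComplexSpace n, ℂ)) :
    ENNReal.ofReal (‖schwartzL2 n f‖ ^ 2) = ∫⁻ z, ‖f z‖ₑ ^ 2 :=
  ofReal_norm_toLp_sq (f.memLp 2 volume)

/-- The Hardy inequality for complex-valued Schwartz functions. -/
lemma HardyInequality.schwartz {w : ComplexSpace n → ℝ≥0∞} (hw : AEMeasurable w volume)
    (h : HardyInequality w) (f : 𝓢(ComplexSpace n, ℂ)) :
    ∫⁻ z, ‖f z‖ₑ ^ 2 * w z ≤ ENNReal.ofReal (∑ k : Fin n,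
      (‖schwartzL2 n (∂_{EuclideanSpace.single k (1 : ℂ)} f)‖ ^ 2
        + ‖schwartzL2 n (∂_{EuclideanSpace.single k Complex.I} f)‖ ^ 2)) := by
  -- To be used for `L = Re` and `L = Im`: the squares of both functions and of their gradients add
  -- up to those of `f`.
  have hL : ∀ L : ℂ →L[ℝ] ℝ, ∫⁻ z, ENNReal.ofReal ((L (f z)) ^ 2) * w z ≤
      ∫⁻ z, ENNReal.ofReal (‖fderiv ℝ (fun z => L (f z)) z‖ ^ 2) := fun L =>
    h.of_memLp hw (L.contDiff.comp (f.smooth ⊤)) (L.comp_memLp' (f.memLp 2 volume))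
      (memLp_fderiv_clm_comp f L)
  have hmeas : ∀ L : ℂ →L[ℝ] ℝ, Measurable fun z => ENNReal.ofReal ((L (f z)) ^ 2) := fun L =>
    ((L.continuous.comp f.continuous).pow 2).measurable.ennreal_ofReal
  have hmeas' : ∀ L : ℂ →L[ℝ] ℝ,
      Measurable fun z => ENNReal.ofReal (‖fderiv ℝ (fun z => L (f z)) z‖ ^ 2) := fun L =>
    ((((L.contDiff.comp (f.smooth ⊤)).continuous_fderiv (by simp)).norm).pow
      2).measurable.ennreal_ofReal
  have e1 : ∀ z, ‖f z‖ₑ ^ 2 * w z = ENNReal.ofReal ((Complex.reCLM (f z)) ^ 2) * w z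
      + ENNReal.ofReal ((Complex.imCLM (f z)) ^ 2) * w z := by
    intro z
    rw [← add_mul, ← ENNReal.ofReal_add (sq_nonneg _) (sq_nonneg _), ← ofReal_norm,
      ← ENNReal.ofReal_pow (norm_nonneg _), Complex.sq_norm, Complex.normSq_apply]
    simp [sq]
  have e2 : ∀ z, ENNReal.ofReal (‖fderiv ℝ (fun z => Complex.reCLM (f z)) z‖ ^ 2)
      + ENNReal.ofReal (‖fderiv ℝ (fun z => Complex.imCLM (f z)) z‖ ^ 2)
      = ∑ k : Fin n, (‖(∂_{EuclideanSpace.single k (1 : ℂ)} f : 𝓢(ComplexSpace n, ℂ)) z‖ₑ ^ 2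
        + ‖(∂_{EuclideanSpace.single k Complex.I} f : 𝓢(ComplexSpace n, ℂ)) z‖ₑ ^ 2) := by
    intro z
    have e3 : ∀ c : ℂ, ‖c‖ₑ ^ 2 = ENNReal.ofReal (c.re ^ 2 + c.im ^ 2) := by
      intro c
      rw [← ofReal_norm, ← ENNReal.ofReal_pow (norm_nonneg _), Complex.sq_norm,
        Complex.normSq_apply]
      ring_nf
    simp_rw [e3]
    rw [← ENNReal.ofReal_add (sq_nonneg _) (sq_nonneg _), norm_fderiv_sq_eq_sum,
      norm_fderiv_sq_eq_sum, ← Finset.sum_add_distrib,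
      ENNReal.ofReal_sum_of_nonneg (fun _ _ => by positivity)]
    refine Finset.sum_congr rfl fun k _ => ?_
    rw [← ENNReal.ofReal_add (by positivity) (by positivity)]
    rw [fderiv_clm_comp_schwartz f Complex.reCLM, fderiv_clm_comp_schwartz f Complex.imCLM]
    simp only [SchwartzMap.lineDerivOp_apply_eq_fderiv,
      ContinuousLinearMap.comp_apply, Complex.reCLM_apply, Complex.imCLM_apply]
    ring_nf
  have hm : ∀ g : 𝓢(ComplexSpace n, ℂ), Measurable fun z => ‖g z‖ₑ ^ 2 := fun g =>
    (g.continuous.enorm.measurable).pow_const 2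
  calc ∫⁻ z, ‖f z‖ₑ ^ 2 * w z
      = (∫⁻ z, ENNReal.ofReal ((Complex.reCLM (f z)) ^ 2) * w z)
        + ∫⁻ z, ENNReal.ofReal ((Complex.imCLM (f z)) ^ 2) * w z := by
        simp_rw [e1]
        exact lintegral_add_left' ((hmeas Complex.reCLM).aemeasurable.mul hw) _
    _ ≤ _ := add_le_add (hL Complex.reCLM) (hL Complex.imCLM)
    _ = ∫⁻ z, ∑ k : Fin n, (‖(∂_{EuclideanSpace.single k (1 : ℂ)} f : 𝓢(ComplexSpace n, ℂ)) z‖ₑ ^ 2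
        + ‖(∂_{EuclideanSpace.single k Complex.I} f : 𝓢(ComplexSpace n, ℂ)) z‖ₑ ^ 2) := by
        rw [← lintegral_add_left (hmeas' _)]
        exact lintegral_congr e2
    _ = _ := by
        rw [lintegral_finsetSum _ fun k _ => (hm _).fun_add (hm _),
          ENNReal.ofReal_sum_of_nonneg (fun _ _ => by positivity)]
        refine Finset.sum_congr rfl fun k _ => ?_
        rw [lintegral_add_left (hm _), ENNReal.ofReal_add (by positivity) (by positivity),
          ofReal_norm_schwartzL2_sq, ofReal_norm_schwartzL2_sq]

lemma norm_wirtingerBar_le (k : Fin n) (φ : ComplexSpace n → ℂ) (z : ComplexSpace n) :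
    ‖wirtingerBar k φ z‖ ≤ ‖fderiv ℝ φ z‖ := by
  have h1 : ‖fderiv ℝ φ z (EuclideanSpace.single k 1)‖ ≤ ‖fderiv ℝ φ z‖ := by
    simpa using (fderiv ℝ φ z).le_opNorm (EuclideanSpace.single k 1)
  have h2 : ‖fderiv ℝ φ z (EuclideanSpace.single k Complex.I)‖ ≤ ‖fderiv ℝ φ z‖ := by
    simpa using (fderiv ℝ φ z).le_opNorm (EuclideanSpace.single k Complex.I)
  rw [wirtingerBar, norm_mul]
  have h3 := norm_add_le (fderiv ℝ φ z (EuclideanSpace.single k 1))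
    (Complex.I * fderiv ℝ φ z (EuclideanSpace.single k Complex.I))
  rw [norm_mul, Complex.norm_I, one_mul] at h3
  simp only [one_div, norm_inv, Complex.norm_ofNat]
  linarith

lemma continuous_wirtingerBar (k : Fin n) {φ : ComplexSpace n → ℂ} (hφ : ContDiff ℝ ∞ φ) :
    Continuous (wirtingerBar k φ) := by
  have := hφ.continuous_fderiv (by simp)
  unfold wirtingerBar
  fun_prop

/-- Weak `∂̄` is tested bilinearly, while the `L²` inner product is sesquilinear. Substituting `φ =
conj f` translates between the two and turns `∂/∂z̄_k` into the `∂/∂z_k` that occurs in `∂̄*`. -/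
lemma wirtingerBar_conj (k : Fin n) (f : 𝓢(ComplexSpace n, ℂ)) (z : ComplexSpace n) :
    wirtingerBar k (fun z => conj (f z)) z = conj (schwartzDz k f z) := by
  have h := fderiv_clm_comp_schwartz f (Complex.conjCLE : ℂ →L[ℝ] ℂ) z
  simp only [ContinuousLinearEquiv.coe_coe, Complex.conjCLE_apply] at h
  simp only [wirtingerBar, h, schwartzDz_eq, _root_.smul_apply, _root_.sub_apply,
    SchwartzMap.lineDerivOp_apply_eq_fderiv, ContinuousLinearMap.comp_apply, smul_eq_mul, map_mul,
    map_sub, map_div₀, map_one, map_ofNat, Complex.conj_I, ContinuousLinearEquiv.coe_coe,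
    Complex.conjCLE_apply]
  ring

lemma MeasureTheory.MemLp.euclidean_apply {ι α : Type*} [Fintype ι] [MeasurableSpace α]
    {μ : Measure α} {p : ℝ≥0∞} {v : α → EuclideanSpace ℂ ι} (hv : MemLp v p μ) (i : ι) :
    MemLp (fun z => v z i) p μ :=
  (EuclideanSpace.proj (𝕜 := ℂ) i).comp_memLp' hv

/-- For square-integrable forms, `∂̄`-closedness can be tested against Schwartz functions. -/
lemma IsDbarClosed.schwartz {q : ℕ} {v : AntiHolForm n q} (hv : IsDbarClosed v)
    (hv2 : MemLp v 2 volume) (K : MultiIndex n (q + 1)) (f : 𝓢(ComplexSpace n, ℂ)) :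
    ∑ k : {k : Fin n // k ∈ K.1},
      K.sign k * ∫ z, v z (K.erase k) * conj (schwartzDz k.1 f z) = 0 := by
  let g : ComplexSpace n → ℂ := fun z => (Complex.conjCLE : ℂ →L[ℝ] ℂ) (f z)
  have hg : ContDiff ℝ ∞ g := (Complex.conjCLE : ℂ →L[ℝ] ℂ).contDiff.comp (f.smooth ⊤)
  have hg2 : MemLp g 2 volume := (Complex.conjCLE : ℂ →L[ℝ] ℂ).comp_memLp' (f.memLp 2 volume)
  have hdg : MemLp (fderiv ℝ g) 2 volume := memLp_fderiv_clm_comp f _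
  obtain ⟨φ, C, hφ, hφs, -, hφd, hφe⟩ := exists_truncation hg
  have hlim : ∀ k : {k : Fin n // k ∈ K.1}, Tendsto
      (fun j => ∫ z, v z (K.erase k) * wirtingerBar k.1 (φ j) z) atTop
      (𝓝 (∫ z, v z (K.erase k) * wirtingerBar k.1 g z)) := by
    intro k
    have hvk := hv2.euclidean_apply (K.erase k)
    -- The majorant is a product of two `L²` functions, independent of `j`.
    refine tendsto_integral_of_dominated_convergence
      (fun z => ‖v z (K.erase k)‖ * (‖fderiv ℝ g z‖ + C * ‖g z‖)) (fun j => ?_) ?_ (fun j => ?_)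
      (.of_forall fun z => ?_)
    · exact hvk.aestronglyMeasurable.mul (continuous_wirtingerBar k.1 (hφ j)).aestronglyMeasurable
    · exact hvk.norm.integrable_mul (hdg.norm.add (hg2.norm.const_mul C))
    · refine .of_forall fun z => ?_
      rw [norm_mul]
      exact mul_le_mul_of_nonneg_left ((norm_wirtingerBar_le _ _ _).trans (hφd j z))
        (norm_nonneg _)
    · refine tendsto_const_nhds.congr' ((hφe z).mono fun j hj => ?_)
      simp only [wirtingerBar, hj.fderiv_eq]
  have hsum := tendsto_finsetSum (Finset.univ) fun k _ => (hlim k).const_mul (K.sign k)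
  have h0 : ∀ j, ∑ k : {k : Fin n // k ∈ K.1},
      K.sign k * ∫ z, v z (K.erase k) * wirtingerBar k.1 (φ j) z = 0 := by
    intro j
    rw [hv.2.2 K (φ j) (hφ j) (hφs j)]
    simp
  simp only [h0] at hsum
  have := tendsto_nhds_unique hsum tendsto_const_nhds
  rw [← this]
  refine Finset.sum_congr rfl fun k _ => ?_
  simp_rw [← wirtingerBar_conj]
  rfl

end Extension

/-- Riesz representation for a functional dominated by the norm of a linear map. -/
lemma exists_inner_eq_of_norm_le {X H : Type*} [AddCommGroup X] [Module ℂ X]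
    [NormedAddCommGroup H] [InnerProductSpace ℂ H] [CompleteSpace H] (T : X →ₗ[ℂ] H)
    (ℓ : X →ₗ[ℂ] ℂ) (M : ℝ) (hM : 0 ≤ M) (h : ∀ x, ‖ℓ x‖ ≤ M * ‖T x‖) :
    ∃ U : H, ‖U‖ ≤ M ∧ ∀ x, inner ℂ U (T x) = ℓ x := by
  have hker : LinearMap.ker T ≤ LinearMap.ker ℓ := by
    intro x hx
    rw [LinearMap.mem_ker] at hx ⊢
    simpa [hx] using h x
  let g : LinearMap.range T →ₗ[ℂ] ℂ :=
    (LinearMap.ker T).liftQ ℓ hker ∘ₗ T.quotKerEquivRange.symm.toLinearMap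
  have hg : ∀ x, g ⟨T x, x, rfl⟩ = ℓ x := by
    intro x
    have : T.quotKerEquivRange.symm ⟨T x, x, rfl⟩ = (LinearMap.ker T).mkQ x := by
      rw [LinearEquiv.symm_apply_eq]; rfl
    simp only [g, LinearMap.comp_apply, LinearEquiv.coe_coe, this]
    rfl
  have hgM : ∀ y, ‖g y‖ ≤ M * ‖y‖ := by
    rintro ⟨_, x, rfl⟩
    rw [hg]
    exact h x
  -- The functional is well defined on the range of `T`, because the bound kills `ker T`.
  -- Hahn–Banach extends it to `H` with the same norm, so the range need be neither closed nor
  -- dense.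
  obtain ⟨G, hG, hGn⟩ := exists_extension_norm_eq (LinearMap.range T) (g.mkContinuous M hgM)
  refine ⟨(InnerProductSpace.toDual ℂ H).symm G, ?_, fun x => ?_⟩
  · rw [LinearIsometryEquiv.norm_map, hGn]
    exact LinearMap.mkContinuous_norm_le _ hM _
  · rw [InnerProductSpace.toDual_symm_apply, ← hg]
    exact hG ⟨T x, x, rfl⟩

/-! ### Weighted Cauchy–Schwarz -/

section Weighted

variable {α : Type*} [MeasurableSpace α] {μ : Measure α}

/-- The Cauchy–Schwarz inequality with a weight which may take the values `0` and `∞`. -/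
lemma lintegral_mul_le_weighted {w a b : α → ℝ≥0∞} (hw : AEMeasurable w μ)
    (ha : AEMeasurable a μ) (hb : AEMeasurable b μ)
    (hA : ∫⁻ z, a z ^ 2 * w z ∂μ ≠ ⊤) (hB : ∫⁻ z, b z ^ 2 / w z ∂μ ≠ ⊤) :
    ∫⁻ z, b z * a z ∂μ
      ≤ (∫⁻ z, a z ^ 2 * w z ∂μ) ^ (1 / 2 : ℝ) * (∫⁻ z, b z ^ 2 / w z ∂μ) ^ (1 / 2 : ℝ) := by
  have hAm : AEMeasurable (fun z => a z ^ 2 * w z) μ := (ha.pow_const 2).mul hw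
  have hBm : AEMeasurable (fun z => b z ^ 2 / w z) μ := (hb.pow_const 2).div hw
  -- Finiteness of the two integrals forces `b = 0` almost everywhere on `{w = 0}` and `a = 0`
  -- almost everywhere on `{w = ∞}`. The left side vanishes there, and elsewhere the weights cancel.
  have hpt : ∀ᵐ z ∂μ, b z * a z ≤
      (a z ^ 2 * w z) ^ (1 / 2 : ℝ) * (b z ^ 2 / w z) ^ (1 / 2 : ℝ) := by
    filter_upwards [ae_lt_top' hAm hA, ae_lt_top' hBm hB] with z h1 h2
    rcases eq_or_ne (w z) 0 with h0 | h0
    · have : b z = 0 := by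
        by_contra hne
        rw [h0, ENNReal.div_zero (pow_ne_zero 2 hne)] at h2
        exact lt_irrefl _ h2
      simp [this]
    rcases eq_or_ne (w z) ⊤ with ht | ht
    · have : a z = 0 := by
        by_contra hne
        rw [ht, ENNReal.mul_top (pow_ne_zero 2 hne)] at h1
        exact lt_irrefl _ h1
      simp [this]
    rw [← ENNReal.mul_rpow_of_nonneg _ _ (by norm_num : (0 : ℝ) ≤ 1 / 2)]
    have : a z ^ 2 * w z * (b z ^ 2 / w z) = (b z * a z) ^ (2 : ℝ) := by
      rw [mul_assoc, ENNReal.mul_div_cancel h0 ht, ENNReal.rpow_ofNat, mul_pow, mul_comm]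
    rw [this, ← ENNReal.rpow_mul]
    norm_num
  refine (lintegral_mono_ae hpt).trans ?_
  have := ENNReal.lintegral_mul_le_Lp_mul_Lq μ Real.HolderConjugate.two_two
    (hAm.pow_const (1 / 2 : ℝ)) (hBm.pow_const (1 / 2 : ℝ))
  have hsq : ∀ x : ℝ≥0∞, (x ^ (1 / 2 : ℝ)) ^ (2 : ℝ) = x := by
    intro x; rw [← ENNReal.rpow_mul]; norm_num
  simp only [hsq] at this
  exact this

end Weighted

/-! ### Forms as `L²` families and the a priori estimate -/

section Forms

variable {n : ℕ}

lemma sum_eq_sum_multiIndex {M : Type*} [AddCommMonoid M] (q : ℕ) (G : Finset (Fin n) → M)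
    (hG : ∀ K, K.card ≠ q → G K = 0) : ∑ K, G K = ∑ J : MultiIndex n q, G J.1 := by
  rw [← Finset.sum_subtype (Finset.univ.filter fun K : Finset (Fin n) => K.card = q)
    (by simp) G]
  exact (Finset.sum_filter_of_ne fun K _ h => by_contra fun hc => h (hG K hc)).symm

/-- The coefficients of a square-integrable form as a family in `L²`, extended by zero. -/
def lpFamily {q : ℕ} {v : AntiHolForm n q} (hv : MemLp v 2 volume) (K : Finset (Fin n)) :
    Lp ℂ 2 (volume : Measure (ComplexSpace n)) :=
  if h : K.card = q then (hv.euclidean_apply ⟨K, h⟩).toLp else 0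

lemma lpFamily_eq_zero {q : ℕ} {v : AntiHolForm n q} (hv : MemLp v 2 volume)
    {K : Finset (Fin n)} (h : K.card ≠ q) : lpFamily hv K = 0 := by
  simp [lpFamily, h]

lemma lpFamily_ae_eq {q : ℕ} {v : AntiHolForm n q} (hv : MemLp v 2 volume)
    (J : MultiIndex n q) : lpFamily hv J.1 =ᵐ[volume] fun z => v z J := by
  rw [lpFamily, dif_pos J.2]
  exact MemLp.coeFn_toLp _

lemma inner_schwartzL2_of_ae_eq {a : Lp ℂ 2 (volume : Measure (ComplexSpace n))}
    {b : ComplexSpace n → ℂ} (h : a =ᵐ[volume] b) (g : 𝓢(ComplexSpace n, ℂ)) :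
    inner ℂ a (schwartzL2 n g) = conj (∫ z, b z * conj (g z)) := by
  rw [L2.inner_def, ← integral_conj]
  refine integral_congr_ae ?_
  filter_upwards [h, SchwartzMap.coeFn_toLp g 2 volume] with z h1 h2
  change inner ℂ (a z) (g.toLp 2 volume z) = _
  rw [h1, h2]
  simp [RCLike.inner_apply, mul_comm]

lemma sum_inner_wedge_eq {q : ℕ} {u : AntiHolForm n q}
    {U : Finset (Fin n) → Lp ℂ 2 (volume : Measure (ComplexSpace n))}
    (hU : ∀ J : MultiIndex n q, U J.1 =ᵐ[volume] fun z => u z J) (K : MultiIndex n (q + 1))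
    (g : 𝓢(ComplexSpace n, ℂ)) :
    ∑ k, inner ℂ (wedge k U K.1) (schwartzL2 n (schwartzDz k g))
      = conj (∑ k : {k : Fin n // k ∈ K.1},
        K.sign k * ∫ z, u z (K.erase k) * conj (schwartzDz k.1 g z)) := by
  rw [map_sum, ← Finset.sum_subset (Finset.subset_univ K.1), ← Finset.sum_coe_sort]
  · refine Finset.sum_congr rfl fun k _ => ?_
    rw [wedge_apply, if_pos k.2, inner_smul_left, map_mul,
      ← inner_schwartzL2_of_ae_eq (hU (K.erase k))]
    rfl
  · intro k _ hk
    rw [wedge_apply, if_neg hk, inner_zero_left]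

/-- This is `∂̄v = 0` in dual form. Closedness gives the terms with `K.card = q + 1`; for every
other `K` the sets `K.erase k` with `k ∈ K` have the wrong cardinality, where `v` has been extended
by zero. -/
lemma sum_inner_formDbarAdj_eq_zero {q : ℕ} {v : AntiHolForm n q} (hv : IsDbarClosed v)
    (hv2 : MemLp v 2 volume) (f : Finset (Fin n) → 𝓢(ComplexSpace n, ℂ)) :
    ∑ J, inner ℂ (lpFamily hv2 J) (schwartzL2 n (formDbarAdj f J)) = 0 := by
  rw [sum_inner_formDbarAdj, neg_eq_zero]
  refine Finset.sum_eq_zero fun K _ => ?_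
  by_cases hK : K.card = q + 1
  · rw [sum_inner_wedge_eq (lpFamily_ae_eq hv2) ⟨K, hK⟩, hv.schwartz hv2, map_zero]
  · refine Finset.sum_eq_zero fun k _ => ?_
    rw [wedge_apply]
    split_ifs with hk
    · have hc := Finset.card_erase_add_one hk
      rw [lpFamily_eq_zero hv2 (by omega)]
      simp
    · simp

lemma formDbar_single {L K : Finset (Fin n)} (ψ : 𝓢(ComplexSpace n, ℂ))
    (h : K.card ≠ L.card + 1) : formDbar (Pi.single L ψ) K = 0 := by
  rw [formDbar_apply, Finset.sum_apply]
  refine Finset.sum_eq_zero fun k _ => ?_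
  rw [wedge_apply]
  split_ifs with hk
  · have hne : K.erase k ≠ L := by
      rintro rfl
      exact h (Finset.card_erase_add_one hk).symm
    simp [Pi.single_eq_of_ne hne]
  · rfl

/-- The a priori estimate dual to the solvability of `∂̄u = v`. -/
lemma norm_sum_inner_le {q : ℕ} {w : ComplexSpace n → ℝ≥0∞} (hw : AEMeasurable w volume)
    (hHardy : HardyInequality w) {v : AntiHolForm n q} (hv : MemLp v 2 volume)
    (hvw : (∫⁻ z, ‖v z‖ₑ ^ 2 / w z) < ⊤) (f : Finset (Fin n) → 𝓢(ComplexSpace n, ℂ)) :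
    ‖∑ K, inner ℂ (lpFamily hv K) (schwartzL2 n (f K))‖
      ≤ 2 * √((∫⁻ z, ‖v z‖ₑ ^ 2 / w z).toReal)
        * √(∑ K, ‖schwartzL2 n (formDirac f K)‖ ^ 2) := by
  -- Only the component of `f` in the degree of `v` enters the pairing; the energy of the other
  -- degrees is nonnegative and is discarded in the bound by `4 * S`.
  let F : ComplexSpace n → EuclideanSpace ℂ (MultiIndex n q) :=
    fun z => WithLp.toLp 2 fun J => f J.1 z
  have hFc : Continuous F :=
    (PiLp.continuous_toLp 2 _).comp (continuous_pi fun J => (f J.1).continuous)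
  have hFn : ∀ z, ‖F z‖ₑ ^ 2 = ∑ J : MultiIndex n q, ‖f J.1 z‖ₑ ^ 2 := by
    intro z
    simp_rw [← ofReal_norm, ← ENNReal.ofReal_pow (norm_nonneg _)]
    rw [EuclideanSpace.norm_sq_eq, ENNReal.ofReal_sum_of_nonneg fun _ _ => by positivity]
  set S := ∑ K, ‖schwartzL2 n (formDirac f K)‖ ^ 2 with hS
  have hS0 : 0 ≤ S := Finset.sum_nonneg fun _ _ => by positivity
  have hFw : ∫⁻ z, ‖F z‖ₑ ^ 2 * w z ≤ ENNReal.ofReal (4 * S) := by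
    have h4 : 4 * S = ∑ K : Finset (Fin n), ∑ k : Fin n,
        (‖schwartzL2 n (∂_{EuclideanSpace.single k (1 : ℂ)} (f K))‖ ^ 2
          + ‖schwartzL2 n (∂_{EuclideanSpace.single k Complex.I} (f K))‖ ^ 2) := by
      rw [hS, sum_norm_sq_formDirac]; ring
    calc ∫⁻ z, ‖F z‖ₑ ^ 2 * w z = ∑ J : MultiIndex n q, ∫⁻ z, ‖f J.1 z‖ₑ ^ 2 * w z := by
          simp_rw [hFn, Finset.sum_mul]
          exact lintegral_finsetSum' _ fun J _ =>
            (((f J.1).continuous.enorm.measurable.pow_const 2).aemeasurable).mul hw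
      _ ≤ ∑ J : MultiIndex n q, ENNReal.ofReal (∑ k : Fin n,
          (‖schwartzL2 n (∂_{EuclideanSpace.single k (1 : ℂ)} (f J.1))‖ ^ 2
            + ‖schwartzL2 n (∂_{EuclideanSpace.single k Complex.I} (f J.1))‖ ^ 2)) :=
          Finset.sum_le_sum fun J _ => hHardy.schwartz hw (f J.1)
      _ ≤ ENNReal.ofReal (4 * S) := by
          rw [← ENNReal.ofReal_sum_of_nonneg (fun _ _ => by positivity), h4]
          refine ENNReal.ofReal_le_ofReal ?_
          rw [← Finset.sum_subtype (Finset.univ.filter fun K : Finset (Fin n) => K.card = q)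
            (by simp) fun K => ∑ k : Fin n,
              (‖schwartzL2 n (∂_{EuclideanSpace.single k (1 : ℂ)} (f K))‖ ^ 2
              + ‖schwartzL2 n (∂_{EuclideanSpace.single k Complex.I} (f K))‖ ^ 2)]
          exact Finset.sum_le_sum_of_subset_of_nonneg (Finset.filter_subset _ _)
            fun _ _ _ => by positivity
  have hsum : ∑ K, inner ℂ (lpFamily hv K) (schwartzL2 n (f K)) = ∫ z, inner ℂ (v z) (F z) := by
    rw [sum_eq_sum_multiIndex q _ fun K hK => by rw [lpFamily_eq_zero hv hK, inner_zero_left]]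
    have hint : ∀ J : MultiIndex n q, Integrable (fun z => inner ℂ (v z J) (f J.1 z)) volume :=
      fun J => by
        simp_rw [RCLike.inner_apply]
        exact ((f J.1).memLp 2 volume).integrable_mul (hv.euclidean_apply J).star
    simp_rw [PiLp.inner_apply]
    rw [integral_finsetSum _ fun J _ => hint J]
    refine Finset.sum_congr rfl fun J _ => ?_
    rw [inner_schwartzL2_of_ae_eq (lpFamily_ae_eq hv J), ← integral_conj]
    simp [RCLike.inner_apply, mul_comm]
  have hkey : ‖∫ z, inner ℂ (v z) (F z)‖ₑ ≤
      ENNReal.ofReal (4 * S) ^ (1 / 2 : ℝ) * (∫⁻ z, ‖v z‖ₑ ^ 2 / w z) ^ (1 / 2 : ℝ) := by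
    calc ‖∫ z, inner ℂ (v z) (F z)‖ₑ ≤ ∫⁻ z, ‖inner ℂ (v z) (F z)‖ₑ :=
          enorm_integral_le_lintegral_enorm _
      _ ≤ ∫⁻ z, ‖v z‖ₑ * ‖F z‖ₑ := by
          refine lintegral_mono fun z => ?_
          simp_rw [← ofReal_norm]
          rw [← ENNReal.ofReal_mul (norm_nonneg _)]
          exact ENNReal.ofReal_le_ofReal (norm_inner_le_norm _ _)
      _ ≤ (∫⁻ z, ‖F z‖ₑ ^ 2 * w z) ^ (1 / 2 : ℝ) * (∫⁻ z, ‖v z‖ₑ ^ 2 / w z) ^ (1 / 2 : ℝ) :=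
          lintegral_mul_le_weighted hw hFc.enorm.measurable.aemeasurable
            hv.aestronglyMeasurable.enorm
            (ne_top_of_le_ne_top ENNReal.ofReal_ne_top hFw) hvw.ne
      _ ≤ _ := by gcongr
  rw [hsum]
  set I := ∫⁻ z, ‖v z‖ₑ ^ 2 / w z
  have hfin : ENNReal.ofReal (4 * S) ^ (1 / 2 : ℝ) * I ^ (1 / 2 : ℝ) ≠ ⊤ :=
    ENNReal.mul_ne_top (ENNReal.rpow_ne_top_of_nonneg (by norm_num) ENNReal.ofReal_ne_top)
      (ENNReal.rpow_ne_top_of_nonneg (by norm_num) hvw.ne)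
  have h := ENNReal.toReal_mono hfin hkey
  rw [toReal_enorm, ENNReal.toReal_mul, ← ENNReal.toReal_rpow, ← ENNReal.toReal_rpow,
    ENNReal.toReal_ofReal (by positivity), ← Real.sqrt_eq_rpow, ← Real.sqrt_eq_rpow,
    Real.sqrt_mul (by norm_num), show (4 : ℝ) = 2 ^ 2 by norm_num,
    Real.sqrt_sq (by norm_num)] at h
  linarith

end Forms

end

/-! ### Solution of `∂̄u = v` by duality -/

theorem theorem2p1 (n q : ℕ) (w : ComplexSpace n → ℝ≥0∞) (hw : AEMeasurable w volume)
    (hHardy : HardyInequality w)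
    (v : AntiHolForm n (q + 1)) (hv_closed : IsDbarClosed v) (hv : MemLp v 2 volume)
    (hvw : (∫⁻ z, ‖v z‖ₑ ^ 2 / w z) < ⊤) :
    ∃ u : AntiHolForm n q, MemLp u 2 volume ∧ IsWeakDbar u v ∧
      (∫⁻ z, ‖u z‖ₑ ^ 2) ≤ 4 * (∫⁻ z, ‖v z‖ₑ ^ 2 / w z) := by
  set I := ∫⁻ z, ‖v z‖ₑ ^ 2 / w z with hI
  set V := lpFamily hv with hV
  let toPi : (Finset (Fin n) → 𝓢(ComplexSpace n, ℂ)) →ₗ[ℂ]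
      PiLp 2 (fun _ : Finset (Fin n) => Lp ℂ 2 (volume : Measure (ComplexSpace n))) :=
    (WithLp.linearEquiv 2 ℂ _).symm.toLinearMap ∘ₗ (schwartzL2 n).compLeft (Finset (Fin n))
  have htoPi : ∀ f K, toPi f K = schwartzL2 n (f K) := fun _ _ => rfl
  let ℓ : (Finset (Fin n) → 𝓢(ComplexSpace n, ℂ)) →ₗ[ℂ] ℂ :=
    (innerSL ℂ (WithLp.toLp 2 V) : PiLp 2 (fun _ : Finset (Fin n) =>
      Lp ℂ 2 (volume : Measure (ComplexSpace n))) →L[ℂ] ℂ).toLinearMap ∘ₗ toPi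
  have hℓ : ∀ f, ℓ f = ∑ K, inner ℂ (V K) (schwartzL2 n (f K)) := fun f => by
    change inner ℂ (WithLp.toLp 2 V) (toPi f) = _
    rw [PiLp.inner_apply]
    rfl
  -- `U` is a weak solution of `DU = v` with components in all degrees.
  obtain ⟨U, hUn, hU⟩ := exists_inner_eq_of_norm_le (toPi ∘ₗ formDirac) ℓ (2 * √I.toReal)
    (by positivity) fun f => by
      rw [hℓ, LinearMap.comp_apply, PiLp.norm_eq_of_L2]
      simp only [htoPi]
      exact norm_sum_inner_le hw hHardy hv hvw f
  have hU' : ∀ f, ∑ K, inner ℂ (U K) (schwartzL2 n (formDirac f K))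
      = ∑ K, inner ℂ (V K) (schwartzL2 n (f K)) := by
    intro f
    rw [← hℓ, ← hU f, PiLp.inner_apply]
    rfl
  -- the component of degree `q + 2` is harmonic, hence vanishes
  have hharm : ∀ L : Finset (Fin n), L.card = q + 2 → U L = 0 := by
    intro L hL
    have hn : 0 < n := by
      have := Finset.card_le_univ L
      simp only [Fintype.card_fin] at this
      omega
    refine eq_zero_of_inner_laplacian_eq_zero hn _ fun ψ => ?_
    -- With `g = ψ dz̄_L`, the test families `∂̄*g` and `∂̄g` add up to `Dg`, and `D²g = -¼Δg`. It
    -- remains to see that `v` is orthogonal to both: to `∂̄*g` by closedness, and to `∂̄g` because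
    -- it has degree `q + 3`.
    have h1 := hU' (formDbarAdj (Pi.single L ψ))
    have h2 := hU' (formDbar (Pi.single L ψ))
    rw [hV, sum_inner_formDbarAdj_eq_zero hv_closed hv] at h1
    rw [Finset.sum_eq_zero (s := Finset.univ) (f := fun K => inner ℂ (V K)
      (schwartzL2 n (formDbar (Pi.single L ψ) K)))] at h2
    · have e1 : ∀ g : Finset (Fin n) → 𝓢(ComplexSpace n, ℂ),
          formDirac (formDbarAdj g) + formDirac (formDbar g)
            = fun K => -∑ k, schwartzDbar k (schwartzDz k (g K)) := by
        intro g
        rw [← formDbar_formDbarAdj_add]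
        simp [formDirac, formDbar_formDbar, formDbarAdj_formDbarAdj]
      have h3 : ∑ K, inner ℂ (U K) (schwartzL2 n
          ((formDirac (formDbarAdj (Pi.single L ψ)) + formDirac (formDbar (Pi.single L ψ))) K))
          = 0 := by
        simp only [Pi.add_apply, map_add, inner_add_right, Finset.sum_add_distrib, h1, h2,
          add_zero]
      rw [e1, Finset.sum_eq_single L] at h3
      · simpa only [Pi.single_eq_same, map_neg, inner_neg_right, neg_eq_zero] using h3
      · intro K _ hK
        simp only [Pi.single_eq_of_ne hK, map_zero, Finset.sum_const_zero, neg_zero,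
          inner_zero_right]
      · simp
    · intro K _
      by_cases hK : K.card = q + 1
      · rw [formDbar_single ψ (by omega), map_zero, inner_zero_right]
      · rw [hV, lpFamily_eq_zero hv hK, inner_zero_left]
  let u : AntiHolForm n q := fun z => WithLp.toLp 2 fun J => U J.1 z
  have huU : ∀ J : MultiIndex n q, U J.1 =ᵐ[volume] fun z => u z J := fun J => .rfl
  have hu : MemLp u 2 volume := by
    refine MemLp.of_eval_piLp fun J => ?_
    exact Lp.memLp (U J.1)
  refine ⟨u, hu, ⟨hu.locallyIntegrable (by norm_num), hv.locallyIntegrable (by norm_num),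
    fun K φ hφ hφs => ?_⟩, ?_⟩
  -- Testing against `g = conj φ dz̄_K` isolates the coefficient `v_K`. In `⟨U, Dg⟩` the part `⟨U,
  -- ∂̄g⟩` vanishes: `∂̄g` has degree `q + 2`, where `U` is zero. What is left, `⟨U, ∂̄*g⟩ = ⟨v,
  -- g⟩`, is the conjugate of the weak equation.
  · obtain ⟨ψ, hψ⟩ : ∃ ψ : 𝓢(ComplexSpace n, ℂ), ∀ z, ψ z = conj (φ z) :=
      ⟨(hφs.comp_left (g := conj) (map_zero _)).toSchwartzMap
        ((Complex.conjCLE : ℂ →L[ℝ] ℂ).contDiff.comp hφ), fun _ => rfl⟩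
    have hφψ : φ = fun z => conj (ψ z) := by ext z; simp [hψ]
    have h := hU' (Pi.single K.1 ψ)
    have e : ∀ J, inner ℂ (U J) (schwartzL2 n (formDirac (Pi.single K.1 ψ) J))
        = inner ℂ (U J) (schwartzL2 n (formDbarAdj (Pi.single K.1 ψ) J)) := by
      intro J
      have h0 : inner ℂ (U J) (schwartzL2 n (formDbar (Pi.single K.1 ψ) J)) = 0 := by
        by_cases hJ : J.card = q + 2
        · rw [hharm J hJ, inner_zero_left]
        · rw [formDbar_single ψ (by rw [K.2]; exact hJ), map_zero, inner_zero_right]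
      change inner ℂ (U J) (schwartzL2 n (formDbar (Pi.single K.1 ψ) J
        + formDbarAdj (Pi.single K.1 ψ) J)) = _
      rw [map_add, inner_add_right, h0, zero_add]
    simp_rw [e] at h
    rw [sum_inner_formDbarAdj, Finset.sum_eq_single K.1, Finset.sum_eq_single K.1,
      Pi.single_eq_same, sum_inner_wedge_eq huU, hV,
      inner_schwartzL2_of_ae_eq (lpFamily_ae_eq hv K), ← map_neg] at h
    · have h' := (starRingEnd ℂ).injective h
      rw [hφψ]
      simp_rw [wirtingerBar_conj]
      rw [← h', neg_neg]
    · intro J _ hJ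
      simp only [Pi.single_eq_of_ne hJ, map_zero, inner_zero_right]
    · simp
    · intro J _ hJ
      simp only [Pi.single_eq_of_ne hJ, map_zero, inner_zero_right, Finset.sum_const_zero]
    · simp
  · have h1 : ∫⁻ z, ‖u z‖ₑ ^ 2 = ENNReal.ofReal (∑ J : MultiIndex n q, ‖U J.1‖ ^ 2) := by
      have hun : ∀ z, ‖u z‖ₑ ^ 2 = ∑ J : MultiIndex n q, ‖U J.1 z‖ₑ ^ 2 := by
        intro z
        simp_rw [← ofReal_norm, ← ENNReal.ofReal_pow (norm_nonneg _)]
        rw [EuclideanSpace.norm_sq_eq, ENNReal.ofReal_sum_of_nonneg fun _ _ => by positivity]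
      simp_rw [hun]
      rw [lintegral_finsetSum' _ fun J _ =>
        ((Lp.aestronglyMeasurable (U J.1)).enorm.pow_const 2),
        ENNReal.ofReal_sum_of_nonneg fun _ _ => by positivity]
      refine Finset.sum_congr rfl fun J _ => ?_
      rw [← ofReal_norm_toLp_sq (Lp.memLp (U J.1)), Lp.toLp_coeFn]
    have h2 : ∑ J : MultiIndex n q, ‖U J.1‖ ^ 2 ≤ ‖U‖ ^ 2 := by
      rw [PiLp.norm_sq_eq_of_L2,
        ← Finset.sum_subtype (Finset.univ.filter fun K : Finset (Fin n) => K.card = q)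
          (by simp) fun K => ‖U K‖ ^ 2]
      exact Finset.sum_le_sum_of_subset_of_nonneg (Finset.filter_subset _ _)
        fun _ _ _ => by positivity
    have h3 : ‖U‖ ^ 2 ≤ 4 * I.toReal := by
      calc ‖U‖ ^ 2 ≤ (2 * √I.toReal) ^ 2 := pow_le_pow_left₀ (norm_nonneg _) hUn 2
        _ = 4 * I.toReal := by rw [mul_pow, Real.sq_sqrt ENNReal.toReal_nonneg]; norm_num
    rw [h1]
    calc _ ≤ ENNReal.ofReal (4 * I.toReal) := ENNReal.ofReal_le_ofReal (h2.trans h3)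
      _ = 4 * I := by
        rw [ENNReal.ofReal_mul (by norm_num), ENNReal.ofReal_toReal hvw.ne]
        norm_num
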